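/- Let $\Bbbk$ be a field of characteristic zero. A conformal algebra over $\Bbbk$ is a unital left $\Bbbk[D]$-module $C$ with $\Bbbk$-bilinear operations $a_{(n)}b$, $n\ge 0$, such that for all $a,b\in C$ one has $a_{(n)}b=0$ for all sufficiently large $n$, and $(Da)_{(n)}b=-n\,a_{(n-1)}b$, $\;a_{(n)}(Db)=D(a_{(n)}b)+n\,a_{(n-1)}b$ for all $n\ge 0$ (the terms with index $n-1$ are zero for $n=0$). Its coefficient algebra $\operatorname{Coeff} C$ is the space $\Bbbk[t,t^{-1}]\otimes_{\Bbbk[D]}C$, where $t^nD=-n\,t^{n-1}$, with the bilinear multiplication $$a(n)\,b(m)=\sum_{s\ge 0}\binom{n}{s}(a_{(s)}b)(n+m-s),\qquad a(n):=t^n\otimes a,\quad a,b\in C,\ n,m\in\mathbb Z .$$ The conformal algebra $C$ is called commutative if $\operatorname{Coeff}C$ is commutative, and Jordan if $\operatorname{Coeff}C$ is a Jordan algebra, i.e. $\operatorname{Coeff}C$ is commutative and satisfies $((uu)v)u=(uu)(vu)$ for all $u,v\in\operatorname{Coeff}C$. **Proposition.** Let $C$ be a commutative conformal algebra over $\Bbbk$.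 Then $C$ is Jordan if and only if for all $n,m,l\ge 0$ and all $a,b,c,d\in C$ $$a_{(n)}(b_{(m)}(c_{(l)}d))+\sum_{s_1=0}^{n}\sum_{s_2=0}^{m}\binom{n}{s_1}\binom{m}{s_2}\bigl(b_{(m-s_2)}(a_{(n-s_1)}c)\bigr)_{(l+s_1+s_2)}d+c_{(l)}(b_{(m)}(a_{(n)}d))$$ $$=\sum_{s=0}^{n}\binom{n}{s}(a_{(n-s)}b)_{(m+s)}(c_{(l)}d)+\sum_{s=0}^{n}\binom{n}{s}(a_{(n-s)}c)_{(l+s)}(b_{(m)}d)+\sum_{s=0}^{l}\binom{l}{s}(c_{(l-s)}b)_{(m+s)}(a_{(n)}d).$$ -/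

import Mathlib

open Polynomial TensorProduct

/-! ### Conformal algebras -/

/-- A conformal algebra over a field `k`: a unital module `C` over `H = k[D]` (here `D` is the
variable `X` of `k[X]`; the `k`-space structure of `C` is the restriction of its `k[X]`-module
structure) with `k`-bilinear `n`-products, `n ≥ 0`, that are local and sesqui-linear.
For `n = 0` the terms with index `n - 1` have coefficient `0`. -/
class ConformalAlgebra (k : Type*) [Field k] (C : Type*) [AddCommGroup C] [Module k C]
    [Module k[X] C] [IsScalarTower k k[X] C] where
  /-- The `n`-th product. -/
  nprod : ℕ → C →ₗ[k] C →ₗ[k] C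
  locality : ∀ a b : C, ∃ N : ℕ, ∀ n : ℕ, N ≤ n → nprod n a b = 0
  nprod_D_left : ∀ (n : ℕ) (a b : C),
    nprod n ((X : k[X]) • a) b = -((n : k) • nprod (n - 1) a b)
  nprod_D_right : ∀ (n : ℕ) (a b : C),
    nprod n a ((X : k[X]) • b) = (X : k[X]) • nprod n a b + (n : k) • nprod (n - 1) a b

/-- `a ∘[k, n] b` is the `n`-th product of `a` and `b` in a conformal algebra over `k`. -/
notation:70 a:71 "∘[" K "," n "]" b:71 => ConformalAlgebra.nprod (k := K) n a b

namespace ConformalAlgebra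

noncomputable section

section Laurent

/-- The divided power `∂ˢ / s!` of the derivation `∂ = d/dt` of `k[t, t⁻¹]`:
the linear map `tⁿ ↦ (n choose s) tⁿ⁻ˢ`, for all integers `n`. -/
def hasse (k : Type*) [Field k] (s : ℕ) : LaurentPolynomial k →ₗ[k] LaurentPolynomial k :=
  (Finsupp.linearCombination k fun n : ℤ =>
    ((Ring.choose n s : ℤ) : k) • (LaurentPolynomial.T (n - s) : LaurentPolynomial k)) ∘ₗ
    (AddMonoidAlgebra.coeffLinearEquiv k).toLinearMap

variable {k : Type*} [Field k]

theorem hasse_T (s : ℕ) (n : ℤ) :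
    hasse k s (LaurentPolynomial.T n) =
      ((Ring.choose n s : ℤ) : k) • LaurentPolynomial.T (n - s) := by
  rw [hasse, LinearMap.comp_apply, LinearEquiv.coe_coe, AddMonoidAlgebra.coeffLinearEquiv_apply,
    LaurentPolynomial.T, AddMonoidAlgebra.coeff_single, Finsupp.linearCombination_single, one_smul]

theorem laurent_hom_ext {M : Type*} [AddCommGroup M] [Module k M]
    {f g : LaurentPolynomial k →ₗ[k] M}
    (h : ∀ n : ℤ, f (LaurentPolynomial.T n) = g (LaurentPolynomial.T n)) : f = g := by
  ext n
  exact h n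

theorem hasse_hasse_one (s : ℕ) (x : LaurentPolynomial k) :
    hasse k s (hasse k 1 x) = ((s + 1 : ℕ) : k) • hasse k (s + 1) x := by
  suffices h : hasse k s ∘ₗ hasse k 1 = ((s + 1 : ℕ) : k) • hasse k (s + 1) from
    LinearMap.congr_fun h x
  refine laurent_hom_ext fun n => ?_
  have h := Ring.choose_smul_choose n (show 1 ≤ s + 1 by omega)
  simp only [Nat.choose_one_right, Ring.choose_one_right, Nat.add_sub_cancel, nsmul_eq_mul,
    Nat.cast_one] at h
  have h' := congrArg (Int.cast : ℤ → k) h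
  simp only [Int.cast_mul, Int.cast_natCast] at h'
  simp only [LinearMap.comp_apply, LinearMap.smul_apply, hasse_T, map_smul, smul_smul,
    Ring.choose_one_right, Nat.cast_one]
  rw [h', sub_sub]
  simp [add_comm]

theorem hasse_one_hasse (s : ℕ) (x : LaurentPolynomial k) :
    hasse k 1 (hasse k s x) = ((s + 1 : ℕ) : k) • hasse k (s + 1) x := by
  suffices h : hasse k 1 ∘ₗ hasse k s = ((s + 1 : ℕ) : k) • hasse k (s + 1) from
    LinearMap.congr_fun h x
  refine laurent_hom_ext fun n => ?_
  have h := Ring.choose_smul_choose n (show s ≤ s + 1 by omega)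
  simp only [Nat.choose_succ_self_right, Ring.choose_one_right, Nat.add_sub_cancel_left,
    nsmul_eq_mul] at h
  have h' := congrArg (Int.cast : ℤ → k) h
  simp only [Int.cast_mul, Int.cast_natCast] at h'
  simp only [LinearMap.comp_apply, LinearMap.smul_apply, hasse_T, map_smul, smul_smul,
    Ring.choose_one_right]
  rw [h', sub_sub]
  simp

theorem hasse_one_mul (x y : LaurentPolynomial k) :
    hasse k 1 (x * y) = hasse k 1 x * y + x * hasse k 1 y := by
  suffices h : (LinearMap.mul k (LaurentPolynomial k)).compr₂ (hasse k 1) =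
      LinearMap.mul k (LaurentPolynomial k) ∘ₗ hasse k 1 +
        (LinearMap.mul k (LaurentPolynomial k)).compl₂ (hasse k 1) from
    LinearMap.congr_fun₂ h x y
  refine laurent_hom_ext fun n => laurent_hom_ext fun m => ?_
  simp only [LinearMap.compr₂_apply, LinearMap.add_apply, LinearMap.comp_apply,
    LinearMap.compl₂_apply, LinearMap.mul_apply', ← LaurentPolynomial.T_add, hasse_T,
    Ring.choose_one_right, smul_mul_assoc, mul_smul_comm]
  rw [show n - ((1 : ℕ) : ℤ) + m = n + m - ((1 : ℕ) : ℤ) by ring,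
    show n + (m - ((1 : ℕ) : ℤ)) = n + m - ((1 : ℕ) : ℤ) by ring, ← add_smul]
  simp

end Laurent

/-! ### The coefficient algebra -/

/-- `k[t, t⁻¹]` as a module over `H = k[D]`, where `D` acts as `-d/dt`: `tⁿ D = -n tⁿ⁻¹`. -/
abbrev LaurentModule (k : Type*) [Field k] : Type _ := Module.AEval' (-hasse k 1)

/-- The underlying space `k[t, t⁻¹] ⊗_H C` of the coefficient algebra. -/
def Coeff (k : Type*) [Field k] (C : Type*) [AddCommGroup C] [Module k[X] C] : Type _ :=
  LaurentModule k ⊗[k[X]] C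

section Coeff

variable {k : Type*} [Field k] {C : Type*} [AddCommGroup C] [Module k[X] C]

instance : AddCommGroup (Coeff k C) := inferInstanceAs (AddCommGroup (LaurentModule k ⊗[k[X]] C))

instance : Module k (Coeff k C) := inferInstanceAs (Module k (LaurentModule k ⊗[k[X]] C))

/-- The element `a(x) = x ⊗_H a` of the coefficient algebra. -/
def coeff (a : C) (x : LaurentPolynomial k) : Coeff k C :=
  (Module.AEval'.of (-hasse k 1) x : LaurentModule k) ⊗ₜ[k[X]] a

theorem coeff_add_left (a b : C) (x : LaurentPolynomial k) :
    coeff (a + b) x = coeff a x + coeff b x :=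
  TensorProduct.tmul_add _ _ _

theorem coeff_add_right (a : C) (x y : LaurentPolynomial k) :
    coeff a (x + y) = coeff a x + coeff a y := by
  simp only [coeff, map_add]
  exact TensorProduct.add_tmul _ _ _

theorem coeff_zero_left (x : LaurentPolynomial k) : coeff (0 : C) x = 0 :=
  TensorProduct.tmul_zero _ _

theorem coeff_smul_right (c : k) (a : C) (x : LaurentPolynomial k) :
    coeff a (c • x) = c • coeff a x := by
  simp only [coeff, map_smul]
  exact TensorProduct.smul_tmul' _ _ _

theorem coeff_neg_right (a : C) (x : LaurentPolynomial k) :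
    coeff a (-x) = -coeff a x := by
  simpa using coeff_smul_right (-1) a x

theorem coeff_smul_left [Module k C] [IsScalarTower k k[X] C] (c : k) (a : C)
    (x : LaurentPolynomial k) : coeff (c • a) x = c • coeff a x := by
  simp only [coeff]
  exact TensorProduct.tmul_smul _ _ _

theorem coeff_X_smul (a : C) (x : LaurentPolynomial k) :
    coeff ((X : k[X]) • a) x = -coeff a (hasse k 1 x) := by
  rw [← coeff_neg_right]
  simp only [coeff]
  rw [← TensorProduct.smul_tmul, Module.AEval'.X_smul_of]
  rfl

/-- An additive pairing balanced over the constants and over `X` is balanced over `k[X]`. -/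
theorem balanced_of_X {M N P : Type*} [AddCommGroup M] [AddCommGroup N] [AddCommGroup P]
    [Module k[X] M] [Module k[X] N] (f : M →+ N →+ P)
    (hC : ∀ (c : k) m n, f ((Polynomial.C c : k[X]) • m) n = f m ((Polynomial.C c : k[X]) • n))
    (hX : ∀ m n, f ((X : k[X]) • m) n = f m ((X : k[X]) • n)) (r : k[X]) (m : M) (n : N) :
    f (r • m) n = f m (r • n) := by
  induction r using Polynomial.induction_on generalizing m n with
  | C c => exact hC c m n
  | add p q hp hq => simp only [add_smul, map_add, AddMonoidHom.add_apply, hp, hq]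
  | monomial i c ih =>
    rw [pow_succ, ← mul_assoc, mul_smul, ih, hX, smul_smul, mul_comm]

theorem coeff_addHom_ext {P : Type*} [AddCommGroup P] {f g : Coeff k C →+ P}
    (h : ∀ (a : C) (x : LaurentPolynomial k), f (coeff a x) = g (coeff a x)) : f = g := by
  refine AddMonoidHom.ext fun u => ?_
  refine TensorProduct.induction_on (R := k[X]) (M := LaurentModule k) (N := C)
    (motive := fun u => f u = g u) u ?_ ?_ ?_
  · exact (map_zero f).trans (map_zero g).symm
  · exact fun y b => h b ((Module.AEval'.of (-hasse k 1)).symm y)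
  · intro u v hu hv
    exact (map_add f u v).trans ((congrArg₂ (· + ·) hu hv).trans (map_add g u v).symm)

theorem C_smul_eq [Module k C] [IsScalarTower k k[X] C] (c : k) (a : C) : (Polynomial.C c : k[X]) • a = c • a := by
  rw [← algebraMap_smul k[X] c a]
  rfl

section Mul

variable [Module k C] [IsScalarTower k k[X] C] [ConformalAlgebra k C]

/-- The product `a(x) b(y) = ∑_{s ≥ 0} (a ₍s₎ b)((∂ˢx / s!) y)` on generators; the sum is finite by
locality. For `x = tⁿ`, `y = tᵐ` the term of index `s` is
`(n choose s) (a ₍s₎ b)(n + m - s)`. -/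
def mulGen (x : LaurentPolynomial k) (a : C) (y : LaurentPolynomial k) (b : C) : Coeff k C :=
  ∑ᶠ s : ℕ, coeff (a ∘[k, s] b) (hasse k s x * y)

theorem mulGen_eq_sum (x : LaurentPolynomial k) (a : C) (y : LaurentPolynomial k) (b : C) (N : ℕ)
    (hN : ∀ n : ℕ, N ≤ n → nprod (k := k) n a b = 0) :
    mulGen x a y b = ∑ s ∈ Finset.range N, coeff (a ∘[k, s] b) (hasse k s x * y) := by
  refine finsum_eq_sum_of_support_subset _ fun s hs => ?_
  by_contra h
  refine hs ?_
  beta_reduce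
  rw [hN s (by simpa using h), coeff_zero_left]

theorem locality₂ (a b a' b' : C) : ∃ N : ℕ, ∀ n : ℕ, N ≤ n →
    nprod (k := k) n a b = 0 ∧ nprod (k := k) n a' b' = 0 := by
  obtain ⟨N, hN⟩ := locality (k := k) a b
  obtain ⟨N', hN'⟩ := locality (k := k) a' b'
  exact ⟨max N N', fun n hn =>
    ⟨hN n (le_trans (le_max_left _ _) hn), hN' n (le_trans (le_max_right _ _) hn)⟩⟩

theorem mulGen_add_x (x x' : LaurentPolynomial k) (a : C) (y : LaurentPolynomial k) (b : C) :
    mulGen (x + x') a y b = mulGen x a y b + mulGen x' a y b := by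
  obtain ⟨N, hN⟩ := locality (k := k) a b
  simp only [mulGen_eq_sum _ a _ b N hN, map_add, add_mul, coeff_add_right,
    Finset.sum_add_distrib]

theorem mulGen_add_y (x : LaurentPolynomial k) (a : C) (y y' : LaurentPolynomial k) (b : C) :
    mulGen x a (y + y') b = mulGen x a y b + mulGen x a y' b := by
  obtain ⟨N, hN⟩ := locality (k := k) a b
  simp only [mulGen_eq_sum _ a _ b N hN, mul_add, coeff_add_right, Finset.sum_add_distrib]

theorem mulGen_add_a (x : LaurentPolynomial k) (a a' : C) (y : LaurentPolynomial k) (b : C) :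
    mulGen x (a + a') y b = mulGen x a y b + mulGen x a' y b := by
  obtain ⟨N, hN⟩ := locality₂ (k := k) a b a' b
  rw [mulGen_eq_sum x a y b N fun n hn => (hN n hn).1,
    mulGen_eq_sum x a' y b N fun n hn => (hN n hn).2,
    mulGen_eq_sum x (a + a') y b N fun n hn => by simp [(hN n hn).1, (hN n hn).2],
    ← Finset.sum_add_distrib]
  simp only [map_add, LinearMap.add_apply, coeff_add_left]

theorem mulGen_add_b (x : LaurentPolynomial k) (a : C) (y : LaurentPolynomial k) (b b' : C) :
    mulGen x a y (b + b') = mulGen x a y b + mulGen x a y b' := by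
  obtain ⟨N, hN⟩ := locality₂ (k := k) a b a b'
  rw [mulGen_eq_sum x a y b N fun n hn => (hN n hn).1,
    mulGen_eq_sum x a y b' N fun n hn => (hN n hn).2,
    mulGen_eq_sum x a y (b + b') N fun n hn => by simp [(hN n hn).1, (hN n hn).2],
    ← Finset.sum_add_distrib]
  simp only [map_add, coeff_add_left]

theorem mulGen_smul_x (c : k) (x : LaurentPolynomial k) (a : C) (y : LaurentPolynomial k) (b : C) :
    mulGen (c • x) a y b = c • mulGen x a y b := by
  obtain ⟨N, hN⟩ := locality (k := k) a b
  simp only [mulGen_eq_sum _ a _ b N hN, map_smul, smul_mul_assoc, coeff_smul_right,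
    Finset.smul_sum]

theorem mulGen_smul_y (c : k) (x : LaurentPolynomial k) (a : C) (y : LaurentPolynomial k) (b : C) :
    mulGen x a (c • y) b = c • mulGen x a y b := by
  obtain ⟨N, hN⟩ := locality (k := k) a b
  simp only [mulGen_eq_sum _ a _ b N hN, mul_smul_comm, coeff_smul_right, Finset.smul_sum]

theorem mulGen_smul_a (c : k) (x : LaurentPolynomial k) (a : C) (y : LaurentPolynomial k) (b : C) :
    mulGen x (c • a) y b = c • mulGen x a y b := by
  obtain ⟨N, hN⟩ := locality (k := k) a b
  rw [mulGen_eq_sum x a y b N hN,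
    mulGen_eq_sum x (c • a) y b N fun n hn => by simp [hN n hn]]
  simp only [map_smul, LinearMap.smul_apply, coeff_smul_left, Finset.smul_sum]

theorem mulGen_smul_b (c : k) (x : LaurentPolynomial k) (a : C) (y : LaurentPolynomial k) (b : C) :
    mulGen x a y (c • b) = c • mulGen x a y b := by
  obtain ⟨N, hN⟩ := locality (k := k) a b
  rw [mulGen_eq_sum x a y b N hN,
    mulGen_eq_sum x a y (c • b) N fun n hn => by simp [hN n hn]]
  simp only [map_smul, coeff_smul_left, Finset.smul_sum]

theorem mulGen_X_left (x : LaurentPolynomial k) (a : C) (y : LaurentPolynomial k) (b : C) :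
    mulGen (-hasse k 1 x) a y b = mulGen x ((X : k[X]) • a) y b := by
  obtain ⟨N, hN⟩ := locality₂ (k := k) a b ((X : k[X]) • a) b
  rw [mulGen_eq_sum _ a y b N fun n hn => (hN n hn).1,
    mulGen_eq_sum x _ y b (N + 1) fun n hn => (hN n (by omega)).2, Finset.sum_range_succ']
  simp only [nprod_D_left, map_neg, hasse_hasse_one, neg_mul, coeff_neg_right, smul_mul_assoc,
    coeff_smul_right, Nat.add_sub_cancel, Nat.cast_zero, zero_smul, neg_zero, coeff_zero_left,
    add_zero]
  refine Finset.sum_congr rfl fun s _ => ?_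
  rw [← coeff_smul_right, ← coeff_neg_right, ← neg_smul, ← neg_smul, coeff_smul_left,
    coeff_smul_right]

theorem mulGen_X_right (x : LaurentPolynomial k) (a : C) (y : LaurentPolynomial k) (b : C) :
    mulGen x a (-hasse k 1 y) b = mulGen x a y ((X : k[X]) • b) := by
  obtain ⟨N, hN⟩ := locality₂ (k := k) a b a ((X : k[X]) • b)
  rw [mulGen_eq_sum x a _ b N fun n hn => (hN n hn).1,
    mulGen_eq_sum x a y _ (N + 1) fun n hn => (hN n (by omega)).2]
  simp only [nprod_D_right, coeff_add_left, coeff_X_smul, coeff_smul_left, Finset.sum_add_distrib]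
  rw [Finset.sum_range_succ, hN N le_rfl |>.1, coeff_zero_left, neg_zero, add_zero,
    Finset.sum_range_succ']
  simp only [Nat.add_sub_cancel, Nat.cast_zero, zero_smul, add_zero]
  rw [← Finset.sum_add_distrib]
  refine Finset.sum_congr rfl fun s _ => ?_
  rw [hasse_one_mul, hasse_one_hasse, mul_neg, coeff_neg_right, coeff_add_right, smul_mul_assoc,
    coeff_smul_right]
  abel

/-- `mulGen` as a biadditive map of its last two arguments. -/
def mulGenHom (x : LaurentPolynomial k) (a : C) : LaurentModule k →+ C →+ Coeff k C :=
  AddMonoidHom.mk' (fun y => AddMonoidHom.mk'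
      (fun b => mulGen x a ((Module.AEval'.of (-hasse k 1)).symm y) b)
      fun b b' => mulGen_add_b x a _ b b')
    fun y y' => AddMonoidHom.ext fun b => by
      rw [map_add]
      exact mulGen_add_y x a _ _ b

theorem mulGenHom_apply (x : LaurentPolynomial k) (a : C) (y : LaurentPolynomial k) (b : C) :
    mulGenHom x a (Module.AEval'.of (-hasse k 1) y) b = mulGen x a y b := rfl

theorem mulGenHom_balanced (x : LaurentPolynomial k) (a : C) (r : k[X]) (y : LaurentModule k)
    (b : C) : mulGenHom x a (r • y) b = mulGenHom x a y (r • b) := by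
  refine balanced_of_X _ (fun c y b => ?_) (fun y b => ?_) r y b
  · obtain ⟨y, rfl⟩ := (Module.AEval'.of (-hasse k 1)).surjective y
    rw [Module.AEval.C_smul, ← map_smul, mulGenHom_apply, mulGenHom_apply, mulGen_smul_y,
      C_smul_eq, mulGen_smul_b]
  · obtain ⟨y, rfl⟩ := (Module.AEval'.of (-hasse k 1)).surjective y
    rw [Module.AEval'.X_smul_of, mulGenHom_apply, mulGenHom_apply]
    exact mulGen_X_right x a y b

/-- Left multiplication by `a(x)` on the coefficient algebra. -/
def mulLeft (x : LaurentPolynomial k) (a : C) : Coeff k C →+ Coeff k C :=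
  TensorProduct.liftAddHom (R := k[X]) (M := LaurentModule k) (N := C)
    (mulGenHom x a) (mulGenHom_balanced x a)

theorem mulLeft_coeff (x : LaurentPolynomial k) (a : C) (y : LaurentPolynomial k) (b : C) :
    mulLeft x a (coeff b y) = mulGen x a y b :=
  (TensorProduct.liftAddHom_tmul (mulGenHom x a) (mulGenHom_balanced x a) _ b).trans
    (mulGenHom_apply x a y b)

/-- `mulLeft` as a biadditive map. -/
def mulLeftHom : LaurentModule k →+ C →+ Coeff k C →+ Coeff k C :=
  AddMonoidHom.mk' (fun x => AddMonoidHom.mk'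
      (fun a => mulLeft ((Module.AEval'.of (-hasse k 1)).symm x) a)
      fun a a' => coeff_addHom_ext fun b y => by
        rw [AddMonoidHom.add_apply, mulLeft_coeff, mulLeft_coeff, mulLeft_coeff, mulGen_add_a])
    fun x x' => AddMonoidHom.ext fun a => coeff_addHom_ext fun b y => by
      rw [map_add]
      change mulLeft _ a (coeff b y) = mulLeft _ a (coeff b y) + mulLeft _ a (coeff b y)
      rw [mulLeft_coeff, mulLeft_coeff, mulLeft_coeff, mulGen_add_x]

theorem mulLeftHom_apply (x : LaurentPolynomial k) (a : C) :
    mulLeftHom (Module.AEval'.of (-hasse k 1) x) a = mulLeft x a := rfl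

theorem mulLeftHom_balanced (r : k[X]) (x : LaurentModule k) (a : C) :
    mulLeftHom (r • x) a = mulLeftHom x (r • a) := by
  refine balanced_of_X _ (fun c x a => ?_) (fun x a => ?_) r x a
  · obtain ⟨x, rfl⟩ := (Module.AEval'.of (-hasse k 1)).surjective x
    refine coeff_addHom_ext fun b y => ?_
    rw [Module.AEval.C_smul, ← map_smul, mulLeftHom_apply, mulLeftHom_apply, mulLeft_coeff,
      mulLeft_coeff, mulGen_smul_x, C_smul_eq, mulGen_smul_a]
  · obtain ⟨x, rfl⟩ := (Module.AEval'.of (-hasse k 1)).surjective x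
    refine coeff_addHom_ext fun b y => ?_
    rw [Module.AEval'.X_smul_of, mulLeftHom_apply, mulLeftHom_apply, mulLeft_coeff, mulLeft_coeff]
    exact mulGen_X_left x a y b

/-- The multiplication of the coefficient algebra, as a biadditive map. -/
def mulHom : Coeff k C →+ Coeff k C →+ Coeff k C :=
  TensorProduct.liftAddHom (R := k[X]) (M := LaurentModule k) (N := C)
    mulLeftHom mulLeftHom_balanced

theorem mulHom_coeff (x : LaurentPolynomial k) (a : C) :
    mulHom (coeff a x) = mulLeft x a :=
  (TensorProduct.liftAddHom_tmul (R := k[X]) (M := LaurentModule k) (N := C)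
    (P := Coeff k C →+ Coeff k C) mulLeftHom mulLeftHom_balanced
    (Module.AEval'.of (-hasse k 1) x) a).trans (mulLeftHom_apply x a)

/-- The coefficient algebra, a (non-associative, non-unital) ring. -/
instance : NonUnitalNonAssocRing (Coeff k C) where
  mul u v := mulHom u v
  left_distrib u v w := map_add (mulHom u) v w
  right_distrib u v w := by
    change mulHom (u + v) w = mulHom u w + mulHom v w
    rw [map_add, AddMonoidHom.add_apply]
  zero_mul u := by
    change mulHom 0 u = 0
    rw [map_zero, AddMonoidHom.zero_apply]
  mul_zero u := map_zero (mulHom u)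

theorem coeff_mul_coeff (a b : C) (x y : LaurentPolynomial k) :
    coeff a x * coeff b y = ∑ᶠ s : ℕ, coeff (a ∘[k, s] b) (hasse k s x * y) := by
  change mulHom (coeff a x) (coeff b y) = mulGen x a y b
  rw [mulHom_coeff, mulLeft_coeff]

/-- The multiplication is `k`-bilinear. -/
instance : IsScalarTower k (Coeff k C) (Coeff k C) where
  smul_assoc c u v := by
    have h : ((AddMonoidHom.mulRight v).comp (DistribSMul.toAddMonoidHom (Coeff k C) c)) =
        (DistribSMul.toAddMonoidHom (Coeff k C) c).comp (AddMonoidHom.mulRight v) := by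
      refine coeff_addHom_ext fun a x => ?_
      have h' : AddMonoidHom.mulLeft (coeff a (c • x)) =
          (DistribSMul.toAddMonoidHom (Coeff k C) c).comp (AddMonoidHom.mulLeft (coeff a x)) := by
        refine coeff_addHom_ext fun b y => ?_
        change mulHom (coeff a (c • x)) (coeff b y) = c • mulHom (coeff a x) (coeff b y)
        rw [mulHom_coeff, mulHom_coeff, mulLeft_coeff, mulLeft_coeff, mulGen_smul_x]
      have h'' := DFunLike.congr_fun h' v
      rw [coeff_smul_right] at h''
      exact h''
    exact DFunLike.congr_fun h u

instance : SMulCommClass k (Coeff k C) (Coeff k C) where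
  smul_comm c u v := by
    have h : ((AddMonoidHom.mulRight (c • v)) : Coeff k C →+ Coeff k C) =
        (DistribSMul.toAddMonoidHom (Coeff k C) c).comp (AddMonoidHom.mulRight v) := by
      refine coeff_addHom_ext fun a x => ?_
      have h' : (AddMonoidHom.mulLeft (coeff a x)).comp
            (DistribSMul.toAddMonoidHom (Coeff k C) c) =
          (DistribSMul.toAddMonoidHom (Coeff k C) c).comp (AddMonoidHom.mulLeft (coeff a x)) := by
        refine coeff_addHom_ext fun b y => ?_
        change mulHom (coeff a x) (c • coeff b y) = c • mulHom (coeff a x) (coeff b y)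
        rw [← coeff_smul_right, mulHom_coeff, mulLeft_coeff, mulLeft_coeff, mulGen_smul_y]
      exact DFunLike.congr_fun h' v
    exact (DFunLike.congr_fun h u).symm

/-- The defining formula
`a(n) b(m) = ∑_{s ≥ 0} (n choose s) (a ₍s₎ b)(n + m - s)`, where `a(n) = tⁿ ⊗_H a`. -/
theorem coeff_T_mul_coeff_T (a b : C) (n m : ℤ) :
    coeff a (LaurentPolynomial.T n : LaurentPolynomial k) * coeff b (LaurentPolynomial.T m) =
      ∑ᶠ s : ℕ, ((Ring.choose n s : ℤ) : k) •
        coeff (a ∘[k, s] b) (LaurentPolynomial.T (n + m - s) : LaurentPolynomial k) := by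
  rw [coeff_mul_coeff]
  refine finsum_congr fun s => ?_
  rw [hasse_T, smul_mul_assoc, ← LaurentPolynomial.T_add, coeff_smul_right]
  congr 3
  ring

end Mul

end Coeff

end

/-! ### Commutative and Jordan algebras and conformal algebras -/

/-- A Jordan algebra: a commutative algebra with `((a a) b) a = (a a) (b a)`. -/
def IsJordanAlgebra (A : Type*) [Mul A] : Prop :=
  (∀ a b : A, a * b = b * a) ∧ ∀ a b : A, ((a * a) * b) * a = (a * a) * (b * a)

/-- A conformal algebra is commutative if its coefficient algebra is commutative. -/
def IsCommutative (k : Type*) [Field k] (C : Type*) [AddCommGroup C] [Module k C]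
    [Module k[X] C] [IsScalarTower k k[X] C] [ConformalAlgebra k C] : Prop :=
  ∀ u v : Coeff k C, u * v = v * u

/-- A conformal algebra is Jordan if its coefficient algebra is Jordan. -/
def IsJordan (k : Type*) [Field k] (C : Type*) [AddCommGroup C] [Module k C]
    [Module k[X] C] [IsScalarTower k k[X] C] [ConformalAlgebra k C] : Prop :=
  IsJordanAlgebra (Coeff k C)

end ConformalAlgebra

/-! Since `Coeff k C` is commutative and torsion-free, the Jordan identity is equivalent to a
4-linear identity J: one direction is polarization, the other puts three of the arguments equal and
cancels 3.

By additivity, J need only be tested on a(x), b(y), c(z), d(w). The product formula, the Leibniz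
rule for divided powers `hasse k s` = ∂ˢ/s! and ∂ʳ/r! ∘ ∂ⁱ/i! = (r+i choose i) ∂ʳ⁺ⁱ/(r+i)! expand
each term of J as a finite sum, over n, m, l, of elements E(n,m,l) ⊗ (∂ⁿx/n!)(∂ᵐy/m!)(∂ˡz/l!)w. The
binomial sums of the conformal identity are the coefficients produced by collecting derivatives
(`sum_hasse_hasse_mul`). Hence the two sides of J have as coefficients E exactly the two sides of
the conformal identity, which therefore implies J.

Conversely, take x = tⁿ, y = tᵐ, z = tˡ with n, m, l ≥ 0 and w = t⁻¹, and apply the projection a(-1)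
↦ a, which kills all a(j) with j ≥ 0. Only E(n,m,l) survives (`coeffResidue_coeff_hasse`), so J
yields the conformal identity. -/

namespace ConformalAlgebra

open Filter Finset

/-! ### Composition and Leibniz rule for divided powers of d/dt -/

section Laurent

variable {k : Type*} [Field k]

theorem hasse_hasse (r i : ℕ) (x : LaurentPolynomial k) :
    hasse k r (hasse k i x) = (r + i).choose i • hasse k (r + i) x := by
  suffices h : hasse k r ∘ₗ hasse k i = (r + i).choose i • hasse k (r + i) from
    LinearMap.congr_fun h x
  refine laurent_hom_ext fun n => ?_
  have h := congrArg (Int.cast : ℤ → k) (Ring.choose_smul_choose n (Nat.le_add_left i r))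
  simp only [nsmul_eq_mul, Int.cast_mul, Int.cast_natCast, Nat.add_sub_cancel] at h
  simp only [LinearMap.comp_apply, LinearMap.smul_apply, hasse_T, map_smul, smul_smul,
    ← Nat.cast_smul_eq_nsmul k]
  rw [h, sub_sub, Nat.cast_add, add_comm (r : ℤ)]

/-- On monomials this is the Chu–Vandermonde identity for binomials with integer upper argument. -/
theorem hasse_mul (s : ℕ) (x y : LaurentPolynomial k) :
    hasse k s (x * y) = ∑ i ∈ range (s + 1), hasse k i x * hasse k (s - i) y := by
  suffices h : (LinearMap.mul k (LaurentPolynomial k)).compr₂ (hasse k s) =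
      ∑ i ∈ range (s + 1),
        (LinearMap.mul k (LaurentPolynomial k) ∘ₗ hasse k i).compl₂ (hasse k (s - i)) by
    have := LinearMap.congr_fun₂ h x y
    rw [LinearMap.sum_apply, LinearMap.sum_apply] at this
    exact this
  refine laurent_hom_ext fun n => laurent_hom_ext fun m => ?_
  simp only [LinearMap.compr₂_apply, LinearMap.sum_apply, LinearMap.comp_apply,
    LinearMap.compl₂_apply, LinearMap.mul_apply', ← LaurentPolynomial.T_add, hasse_T,
    smul_mul_smul_comm]
  rw [Ring.add_choose_eq s (Commute.all n m), Nat.sum_antidiagonal_eq_sum_range_succ_mk,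
    Int.cast_sum, sum_smul]
  refine sum_congr rfl fun i hi => ?_
  rw [Int.cast_mul, Nat.cast_sub (by simpa [Nat.lt_succ_iff] using hi)]
  congr 2
  ring

end Laurent

/-! ### Reordering finite sums -/

section Sums

theorem sum_range_triangle {A : Type*} [AddCommMonoid A] (K : ℕ) (f : ℕ → ℕ → A)
    (hf : ∀ i q, K ≤ i + q → f i q = 0) :
    ∑ n ∈ range K, ∑ i ∈ range (n + 1), f i (n - i) = ∑ i ∈ range K, ∑ q ∈ range K, f i q := by
  rw [sum_range_diag_flip]
  refine sum_congr rfl fun i _ => sum_subset (range_subset_range.2 (Nat.sub_le K i)) ?_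
  intro q _ hq
  exact hf i q (by simp at hq; omega)

variable {k : Type*} [Field k] {C A : Type*} [AddCommGroup C] [AddCommGroup A]

/-- Reordering of a double sum of iterated divided power derivatives of a product. -/
theorem sum_hasse_hasse_mul (φ : C →+ LaurentPolynomial k →+ A) (c : ℕ → ℕ → C) {N K : ℕ}
    (hi : ∀ i q, N ≤ i → c i q = 0) (hq : ∀ i q, N ≤ q → c i q = 0) (hK : N + N ≤ K)
    (x z : LaurentPolynomial k) :
    ∑ i ∈ range K, ∑ q ∈ range K, φ (c i q) (hasse k q (hasse k i x * z)) =
      ∑ n ∈ range K, ∑ l ∈ range K,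
        φ (∑ i ∈ range (n + 1), n.choose i • c (n - i) (l + i)) (hasse k n x * hasse k l z) := by
  -- Leibniz splits the q derivatives as q = r + l, with r falling on the already derived x and l on
  -- z. The terms with r + l ≥ K that complete the triangle to a square vanish.
  have h₁ (i : ℕ) : ∑ q ∈ range K, φ (c i q) (hasse k q (hasse k i x * z)) =
      ∑ r ∈ range K, ∑ l ∈ range K,
        φ (c i (r + l)) ((r + i).choose i • (hasse k (r + i) x * hasse k l z)) := by
    rw [← sum_range_triangle]
    · refine sum_congr rfl fun q _ => ?_
      rw [hasse_mul, map_sum]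
      refine sum_congr rfl fun r hr => ?_
      rw [Nat.add_sub_cancel' (by simpa [Nat.lt_succ_iff] using hr), hasse_hasse, smul_mul_assoc]
    · intro r l hrl
      rw [hq i (r + l) (by omega), map_zero, AddMonoidHom.zero_apply]
  simp only [h₁]
  -- Collect by n = r + i, the total order of differentiation of x. If i + r ≥ K ≥ 2N, then i ≥ N or
  -- r ≥ N, so the added terms vanish; this is why the cut-off is doubled.
  rw [← sum_range_triangle K fun i r => ∑ l ∈ range K,
        φ (c i (r + l)) ((r + i).choose i • (hasse k (r + i) x * hasse k l z))]
  · refine sum_congr rfl fun n _ => ?_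
    rw [sum_comm]
    refine sum_congr rfl fun l _ => ?_
    -- The reflection i ↦ n - i turns c i (n - i + l) into c (n - i) (l + i), the indexing of the
    -- conformal identity.
    rw [← sum_flip, map_sum, AddMonoidHom.finsetSum_apply]
    refine sum_congr rfl fun i hi => ?_
    have hi' : i ≤ n := by simpa [Nat.lt_succ_iff] using hi
    rw [Nat.sub_sub_self hi', Nat.add_sub_cancel' hi', Nat.choose_symm hi', map_nsmul, map_nsmul,
      AddMonoidHom.nsmul_apply, add_comm i l]
  · intro i r hir
    refine sum_eq_zero fun l _ => ?_
    rcases le_or_gt N i with h | h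
    · rw [hi i _ h, map_zero, AddMonoidHom.zero_apply]
    · rw [hq i _ (by omega), map_zero, AddMonoidHom.zero_apply]

/-- An eventual property of the members of a family with finite support holds eventually for all
of them at once, if it always holds for zero. -/
theorem eventually_forall_of_support {g : ℕ → C} {N : ℕ} (hg : ∀ i, N ≤ i → g i = 0)
    {Q : C → ℕ → Prop} (h₀ : ∀ K, Q 0 K) (h : ∀ i, ∀ᶠ K in atTop, Q (g i) K) :
    ∀ᶠ K in atTop, ∀ i, Q (g i) K := by
  have h' : ∀ᶠ K in atTop, ∀ i ∈ range N, Q (g i) K :=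
    (eventually_all_finset (range N)).2 fun i _ => h i
  filter_upwards [h'] with K hK i
  rcases le_or_gt N i with hi | hi
  · rw [hg i hi]
    exact h₀ K
  · exact hK i (mem_range.2 hi)

end Sums

section CoeffMulHom

variable {k : Type*} [Field k] {C : Type*} [AddCommGroup C] [Module k[X] C]

/-- `coeff e (v * w)` as a biadditive map of `e` and `v`. -/
noncomputable def coeffMulHom (w : LaurentPolynomial k) : C →+ LaurentPolynomial k →+ Coeff k C :=
  AddMonoidHom.mk' (fun e => AddMonoidHom.mk' (fun v => coeff e (v * w)) fun v v' => by
      rw [add_mul, coeff_add_right])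
    fun e e' => AddMonoidHom.ext fun v => coeff_add_left e e' (v * w)

theorem coeffMulHom_apply (w : LaurentPolynomial k) (e : C) (v : LaurentPolynomial k) :
    coeffMulHom w e v = coeff e (v * w) := rfl

end CoeffMulHom

/-! ### Expansions of products in the coefficient algebra -/

section Products

variable {k : Type*} [Field k] {C : Type*} [AddCommGroup C] [Module k C] [Module k[X] C]
  [IsScalarTower k k[X] C] [ConformalAlgebra k C]

variable (k) in
theorem eventually_nprod_eq_zero (a b : C) :
    ∀ᶠ N in atTop, ∀ n : ℕ, N ≤ n → nprod (k := k) n a b = 0 := by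
  obtain ⟨N, hN⟩ := locality (k := k) a b
  filter_upwards [eventually_ge_atTop N] with K hK n hn using hN n (hK.trans hn)

/-- Stating expansions for all large `K` lets several of them share one cut-off by intersecting
filters. Uniformity in `y` is needed because `y` is later replaced by the terms of another
expansion. -/
theorem eventually_coeff_mul_coeff (a b : C) (x : LaurentPolynomial k) :
    ∀ᶠ K in atTop, ∀ y : LaurentPolynomial k, coeff a x * coeff b y =
      ∑ s ∈ range K, coeff (a ∘[k, s] b) (hasse k s x * y) := by
  filter_upwards [eventually_nprod_eq_zero k a b] with K hK y
  rw [← mulGen_eq_sum x a y b K hK]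
  exact coeff_mul_coeff a b x y

variable (k) in
/-- The coefficient of `(∂ⁿx / n!)(∂ᵐy / m!) z` in `(a(x) b(y)) e(z)`. -/
noncomputable def nestedProd (n m : ℕ) (a b e : C) : C :=
  ∑ i ∈ range (n + 1), n.choose i • ((a ∘[k, n - i] b) ∘[k, m + i] e)

theorem nestedProd_zero_middle (n m : ℕ) (a e : C) : nestedProd k n m a 0 e = 0 := by
  simp [nestedProd]

theorem nestedProd_zero_right (n m : ℕ) (a b : C) : nestedProd k n m a b 0 = 0 := by
  simp [nestedProd]

/-- Only finitely many products of `a` and `b` are nonzero, so one locality bound serves all of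
them. -/
theorem eventually_nprod_nprod_left_eq_zero (a b e : C) :
    ∀ᶠ N in atTop, ∀ i q : ℕ, N ≤ q → nprod (k := k) q (a ∘[k, i] b) e = 0 := by
  obtain ⟨N, hN⟩ := locality (k := k) a b
  exact eventually_forall_of_support hN (Q := fun g N => ∀ q, N ≤ q → nprod (k := k) q g e = 0)
    (by simp) fun i => eventually_nprod_eq_zero k _ e

/-- Expanding naively gives the derivatives ∂^q of (∂ⁱx)y; collecting them by the orders on x and on
y produces `nestedProd`. -/
theorem eventually_mul_coeff (a b e : C) :
    ∀ᶠ K in atTop, ∀ x y w : LaurentPolynomial k, coeff a x * coeff b y * coeff e w =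
      ∑ n ∈ range K, ∑ m ∈ range K,
        coeff (nestedProd k n m a b e) (hasse k n x * hasse k m y * w) := by
  obtain ⟨N, hN, hN'⟩ := ((eventually_nprod_eq_zero k a b).and
    (eventually_nprod_nprod_left_eq_zero (k := k) a b e)).exists
  filter_upwards [eventually_ge_atTop (N + N)] with K hK x y w
  have h := sum_hasse_hasse_mul (coeffMulHom (k := k) w)
    (fun i q => (a ∘[k, i] b) ∘[k, q] e) (N := N) (K := K)
    (fun i q hi => by simp [hN i hi]) (fun i q hq => hN' i q hq) hK x y
  simp only [coeffMulHom_apply] at h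
  simp only [nestedProd]
  rw [← h, coeff_mul_coeff]
  change mulGen x a y b * _ = _
  rw [mulGen_eq_sum x a y b K fun n hn => hN n (by omega), sum_mul]
  refine sum_congr rfl fun i _ => ?_
  rw [coeff_mul_coeff]
  exact mulGen_eq_sum _ _ _ _ K fun n hn => hN' i n (by omega)

/-- Expansion of `(a(x) b(y)) (c(z) d(w))`. -/
theorem eventually_mul_mul_mul (a b c d : C) (x y z w : LaurentPolynomial k) :
    ∀ᶠ K in atTop, coeff a x * coeff b y * (coeff c z * coeff d w) =
      ∑ n ∈ range K, ∑ m ∈ range K, ∑ l ∈ range K,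
        coeff (nestedProd k n m a b (c ∘[k, l] d))
          (hasse k n x * hasse k m y * (hasse k l z * w)) := by
  obtain ⟨N, hN⟩ := locality (k := k) c d
  have h := eventually_forall_of_support hN (Q := fun e K => ∀ x y w : LaurentPolynomial k,
      coeff a x * coeff b y * coeff e w = ∑ n ∈ range K, ∑ m ∈ range K,
        coeff (nestedProd k n m a b e) (hasse k n x * hasse k m y * w))
    (fun K x y w => by simp [nestedProd_zero_right, coeff_zero_left])
    fun i => eventually_mul_coeff a b _
  filter_upwards [h, eventually_coeff_mul_coeff c d z] with K hK hK'
  rw [hK' w, mul_sum]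
  simp only [hK]
  rw [sum_comm]
  exact sum_congr rfl fun n _ => sum_comm

theorem eventually_coeff_mul_mul (a b c : C) (x y : LaurentPolynomial k) :
    ∀ᶠ K in atTop, ∀ z : LaurentPolynomial k, coeff a x * (coeff b y * coeff c z) =
      ∑ n ∈ range K, ∑ m ∈ range K,
        coeff (a ∘[k, n] (b ∘[k, m] c)) (hasse k n x * (hasse k m y * z)) := by
  obtain ⟨N, hN⟩ := locality (k := k) b c
  have h := eventually_forall_of_support hN (Q := fun e K => ∀ w : LaurentPolynomial k,
      coeff a x * coeff e w = ∑ s ∈ range K, coeff (a ∘[k, s] e) (hasse k s x * w))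
    (fun K w => by simp [coeff_zero_left])
    fun i => eventually_coeff_mul_coeff a _ x
  filter_upwards [h, eventually_coeff_mul_coeff b c y] with K hK hK' z
  rw [hK' z, mul_sum]
  simp only [hK]
  rw [sum_comm]

/-- Expansion of `a(x) (b(y) (c(z) d(w)))`. -/
theorem eventually_coeff_mul_mul_mul (a b c d : C) (x y z w : LaurentPolynomial k) :
    ∀ᶠ K in atTop, coeff a x * (coeff b y * (coeff c z * coeff d w)) =
      ∑ n ∈ range K, ∑ m ∈ range K, ∑ l ∈ range K,
        coeff (a ∘[k, n] (b ∘[k, m] (c ∘[k, l] d)))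
          (hasse k n x * (hasse k m y * (hasse k l z * w))) := by
  obtain ⟨N, hN⟩ := locality (k := k) c d
  have h := eventually_forall_of_support hN (Q := fun e K => ∀ w : LaurentPolynomial k,
      coeff a x * (coeff b y * coeff e w) = ∑ n ∈ range K, ∑ m ∈ range K,
        coeff (a ∘[k, n] (b ∘[k, m] e)) (hasse k n x * (hasse k m y * w)))
    (fun K w => by simp [coeff_zero_left])
    fun i => eventually_coeff_mul_mul a b _ x y
  filter_upwards [h, eventually_coeff_mul_coeff c d z] with K hK hK'
  rw [hK' w, mul_sum, mul_sum]
  simp only [hK]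
  rw [sum_comm]
  exact sum_congr rfl fun n _ => sum_comm

/-- Expansion of `(b(y) (a(x) c(z))) d(w)`. -/
theorem eventually_coeff_mul_mul_mul_coeff (a b c d : C) (x y z w : LaurentPolynomial k) :
    ∀ᶠ K in atTop, coeff b y * (coeff a x * coeff c z) * coeff d w =
      ∑ m ∈ range K, ∑ n ∈ range K, ∑ l ∈ range K,
        coeff (∑ i ∈ range (n + 1), n.choose i • nestedProd k m (l + i) b (a ∘[k, n - i] c) d)
          (hasse k n x * hasse k l z * (hasse k m y * w)) := by
  obtain ⟨N₀, hN₀⟩ := locality (k := k) a c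
  have h := eventually_forall_of_support hN₀ (Q := fun e K => ∀ y z w : LaurentPolynomial k,
      coeff b y * coeff e z * coeff d w = ∑ m ∈ range K, ∑ q ∈ range K,
        coeff (nestedProd k m q b e d) (hasse k m y * hasse k q z * w))
    (fun K y z w => by simp [nestedProd_zero_middle, coeff_zero_left])
    fun i => eventually_mul_coeff b _ d
  have h' := eventually_forall_of_support hN₀
    (Q := fun e N => ∀ i q : ℕ, N ≤ q → nprod (k := k) q (b ∘[k, i] e) d = 0)
    (by simp) fun i => eventually_nprod_nprod_left_eq_zero b _ d
  obtain ⟨N, hN', hN⟩ := (h'.and (eventually_ge_atTop N₀)).exists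
  filter_upwards [h, eventually_coeff_mul_coeff a c x, eventually_ge_atTop (N + N)] with K hK hK' hNK
  rw [hK' z, mul_sum, sum_mul]
  simp only [hK]
  rw [sum_comm]
  refine sum_congr rfl fun m _ => ?_
  -- After b(y) and d(w) are multiplied in, a derivative of order q still acts on (∂ⁱx/i!)z.
  -- Collecting once more yields the second binomial sum.
  have h := sum_hasse_hasse_mul (coeffMulHom (k := k) (hasse k m y * w))
    (fun i q => nestedProd k m q b (a ∘[k, i] c) d) (N := N) (K := K)
    (fun i q hi => by rw [hN₀ i (by omega), nestedProd_zero_middle])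
    (fun i q hq => sum_eq_zero fun j _ => by rw [hN' i _ _ (by omega), smul_zero]) hNK x z
  simp only [coeffMulHom_apply] at h
  rw [← h]
  refine sum_congr rfl fun i _ => sum_congr rfl fun q _ => ?_
  congr 1
  ring

end Products

/-! ### The Jordan identity and its linearization -/

section Jordan

open Ring in
-- Polarization gives 2([L_a, L_{cd}] + [L_c, L_{da}] + [L_d, L_{ac}]) = 0 for the multiplication
-- operators. Cancel 2 and evaluate at b.
theorem linearized_jordan {A : Type*} [NonUnitalNonAssocCommRing A] [IsAddTorsionFree A]
    (h : ∀ u v : A, u * u * v * u = u * u * (v * u)) (a b c d : A) :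
    a * (b * (c * d)) + b * (a * c) * d + c * (b * (a * d)) =
      a * b * (c * d) + a * c * (b * d) + c * b * (a * d) := by
  have : IsCommJordan A := ⟨fun u v => by
    rw [mul_comm (u * v), mul_comm u v, ← h u v, mul_comm _ u, mul_comm _ v]⟩
  have h₃ := DFunLike.congr_fun (two_nsmul_lie_lmul_lmul_add_add_eq_zero a c d) b
  replace h₃ := (nsmul_eq_zero_iff_right two_ne_zero).1 h₃
  simp only [Ring.lie_def] at h₃
  change a * (c * d * b) - c * d * (a * b) + (c * (d * a * b) - d * a * (c * b)) +
    (d * (a * c * b) - a * c * (d * b)) = 0 at h₃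
  rw [mul_comm (c * d) b, mul_comm (c * d) (a * b), mul_comm d a, mul_comm (a * d) b,
    mul_comm (a * d) (c * b), mul_comm d (a * c * b), mul_comm (a * c) b, mul_comm d b] at h₃
  rw [← sub_eq_zero, ← h₃]
  abel

theorem jordan_of_linearized {A : Type*} [NonUnitalNonAssocCommRing A] [IsAddTorsionFree A]
    (h : ∀ a b c d : A, a * (b * (c * d)) + b * (a * c) * d + c * (b * (a * d)) =
      a * b * (c * d) + a * c * (b * d) + c * b * (a * d)) (u v : A) :
    u * u * v * u = u * u * (v * u) := by
  -- By commutativity both sides become three copies of the corresponding side of the Jordan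
  -- identity.
  have h₁ := h u v u u
  rw [mul_comm u v, mul_comm (v * u) (u * u), mul_comm u (v * (u * u)), mul_comm v (u * u)] at h₁
  refine nsmul_right_injective three_ne_zero ?_
  simpa only [succ_nsmul, zero_nsmul, zero_add] using h₁

end Jordan

/-! ### Projection of the coefficient algebra onto C -/

section Residue

variable (k : Type*) [Field k]

/-- The linear map `k[t, t⁻¹] → k[X]` with kernel `k[t]` that sends `t⁻ⁿ⁻¹` to `Xⁿ / n!`. -/
noncomputable def residue : LaurentPolynomial k →ₗ[k] k[X] :=
  (Finsupp.linearCombination k fun n : ℤ =>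
    if n < 0 then Polynomial.monomial (-n - 1).toNat (((-n - 1).toNat.factorial : k)⁻¹) else 0) ∘ₗ
    (AddMonoidAlgebra.coeffLinearEquiv k).toLinearMap

variable {k}

theorem residue_T (n : ℤ) : residue k (LaurentPolynomial.T n) =
    if n < 0 then Polynomial.monomial (-n - 1).toNat (((-n - 1).toNat.factorial : k)⁻¹) else 0 := by
  rw [residue, LinearMap.comp_apply, LinearEquiv.coe_coe, AddMonoidAlgebra.coeffLinearEquiv_apply,
    LaurentPolynomial.T, AddMonoidAlgebra.coeff_single, Finsupp.linearCombination_single, one_smul]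

/-- This `k[X]`-linearity lets `residue` descend to the tensor product. It holds because -d/dt sends
t^(-j-1) to (j+1) t^(-j-2), and (j+1)/(j+1)! = 1/j!. -/
theorem residue_neg_hasse_one [CharZero k] (x : LaurentPolynomial k) :
    residue k ((-hasse k 1) • x) = (X : k[X]) • residue k x := by
  suffices h : residue k ∘ₗ (-hasse k 1) = LinearMap.mulLeft k (X : k[X]) ∘ₗ residue k from
    LinearMap.congr_fun h x
  refine laurent_hom_ext fun n => ?_
  simp only [LinearMap.comp_apply, LinearMap.neg_apply, hasse_T, map_neg, map_smul, residue_T,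
    LinearMap.mulLeft_apply, Ring.choose_one_right]
  rcases lt_or_ge n 0 with hn | hn
  · obtain ⟨j, rfl⟩ : ∃ j : ℕ, n = -(j : ℤ) - 1 := ⟨(-n - 1).toNat, by omega⟩
    rw [if_pos (by omega), if_pos hn, Polynomial.X_mul_monomial, Polynomial.smul_monomial,
      ← Polynomial.monomial_neg, show (-(-(j : ℤ) - 1 - (1 : ℕ)) - 1).toNat = j + 1 by omega,
      show (-(-(j : ℤ) - 1) - 1).toNat = j by omega, Nat.factorial_succ]
    congr 1
    have h₁ : (j : k) + 1 ≠ 0 := Nat.cast_add_one_ne_zero j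
    have h₂ : (j.factorial : k) ≠ 0 := Nat.cast_ne_zero.2 j.factorial_ne_zero
    push_cast
    rw [smul_eq_mul]
    field_simp
    ring
  · rw [if_neg hn.not_gt, mul_zero]
    -- At exponent 0 the derivative formally involves t⁻¹, whose residue is nonzero, but its
    -- coefficient is 0.
    rcases hn.eq_or_lt with rfl | hn
    · simp
    · rw [if_neg (by omega), smul_zero, neg_zero]

/-- The projection of the coefficient algebra onto `C` along the span of the `a(n)`, `n ≥ 0`, that
sends `a(-1)` to `a`. -/
noncomputable def coeffResidue [CharZero k] {C : Type*} [AddCommGroup C] [Module k[X] C] :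
    Coeff k C →+ C :=
  ((TensorProduct.lid k[X] C).toLinearMap ∘ₗ
    (LinearMap.ofAEval (-hasse k 1) (residue k) residue_neg_hasse_one).rTensor C).toAddMonoidHom

theorem coeffResidue_coeff [CharZero k] {C : Type*} [AddCommGroup C] [Module k[X] C]
    (a : C) (x : LaurentPolynomial k) : coeffResidue (coeff a x) = residue k x • a := rfl

theorem coeffResidue_coeff_T_neg_one [CharZero k] {C : Type*} [AddCommGroup C] [Module k[X] C]
    (a : C) : coeffResidue (coeff a (LaurentPolynomial.T (-1) : LaurentPolynomial k)) = a := by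
  rw [coeffResidue_coeff, residue_T]
  simp

theorem coeffResidue_coeff_hasse [CharZero k] {C : Type*} [AddCommGroup C] [Module k[X] C]
    (E : ℕ → ℕ → ℕ → C) (n m l : ℕ) {K : ℕ} (hn : n < K) (hm : m < K) (hl : l < K) :
    ∑ n' ∈ range K, ∑ m' ∈ range K, ∑ l' ∈ range K, coeffResidue (coeff (E n' m' l')
      (hasse k n' (LaurentPolynomial.T n) * hasse k m' (LaurentPolynomial.T m) *
        hasse k l' (LaurentPolynomial.T l) * LaurentPolynomial.T (-1))) = E n m l := by
  have h₀ (n' m' l' : ℕ) (h : ¬(n' = n ∧ m' = m ∧ l' = l)) :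
      residue k (hasse k n' (LaurentPolynomial.T n) * hasse k m' (LaurentPolynomial.T m) *
        hasse k l' (LaurentPolynomial.T l) * LaurentPolynomial.T (-1)) = 0 := by
    simp only [hasse_T, smul_mul_assoc, mul_smul_comm, ← LaurentPolynomial.T_add, map_smul,
      residue_T, Ring.choose_natCast]
    split_ifs with hlt
    -- The exponent is (n-n') + (m-m') + (l-l') - 1. If it is negative and the differences are not
    -- all zero, one of them is negative, and then its binomial coefficient vanishes.
    · rcases (show n < n' ∨ m < m' ∨ l < l' by omega) with h | h | h <;>
        simp [Nat.choose_eq_zero_of_lt h]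
    · simp only [smul_zero]
  rw [sum_eq_single_of_mem n (mem_range.2 hn), sum_eq_single_of_mem m (mem_range.2 hm),
    sum_eq_single_of_mem l (mem_range.2 hl)]
  · simp [hasse_T, coeffResidue_coeff_T_neg_one, Ring.choose_natCast]
  · intro l' _ h
    rw [coeffResidue_coeff, h₀ _ _ _ (by omega), zero_smul]
  · intro m' _ h
    exact sum_eq_zero fun l' _ => by rw [coeffResidue_coeff, h₀ _ _ _ (by omega), zero_smul]
  · intro n' _ h
    exact sum_eq_zero fun m' _ => sum_eq_zero fun l' _ => by
      rw [coeffResidue_coeff, h₀ _ _ _ (by omega), zero_smul]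

end Residue

/-! ### Comparison of the two identities -/

section Main

theorem sum_range_reverse {A : Type*} [AddCommMonoid A] (K : ℕ) (f : ℕ → ℕ → ℕ → A) :
    ∑ l ∈ range K, ∑ m ∈ range K, ∑ n ∈ range K, f l m n =
      ∑ n ∈ range K, ∑ m ∈ range K, ∑ l ∈ range K, f l m n :=
  (sum_congr rfl fun _ _ => sum_comm).trans (sum_comm.trans (sum_congr rfl fun _ _ => sum_comm))

theorem coeff_induction {k : Type*} [Field k] {C : Type*} [AddCommGroup C] [Module k[X] C]
    {p : Coeff k C → Prop} (u : Coeff k C) (coeff : ∀ a x, p (coeff a x))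
    (add : ∀ u v, p u → p v → p (u + v)) : p u := by
  refine TensorProduct.induction_on (R := k[X]) (M := LaurentModule k) (N := C)
    (motive := p) u ?_ ?_ add
  · have h := coeff 0 0
    rwa [coeff_zero_left] at h
  · exact fun y b => coeff b ((Module.AEval'.of (-hasse k 1)).symm y)

variable {k : Type*} [Field k] {C : Type*} [AddCommGroup C] [Module k C] [Module k[X] C]
  [IsScalarTower k k[X] C] [ConformalAlgebra k C]

variable (k) in
/-- The left-hand side of the conformal Jordan identity. -/
noncomputable def jordanLeft (n m l : ℕ) (a b c d : C) : C :=
  a ∘[k, n] (b ∘[k, m] (c ∘[k, l] d))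
    + ∑ i ∈ range (n + 1), n.choose i • nestedProd k m (l + i) b (a ∘[k, n - i] c) d
    + c ∘[k, l] (b ∘[k, m] (a ∘[k, n] d))

variable (k) in
/-- The right-hand side of the conformal Jordan identity. -/
noncomputable def jordanRight (n m l : ℕ) (a b c d : C) : C :=
  nestedProd k n m a b (c ∘[k, l] d) + nestedProd k n l a c (b ∘[k, m] d)
    + nestedProd k l m c b (a ∘[k, n] d)

/-- The three products are expanded in different orders of the variables; reordering the sums puts
them over the same Laurent factors, so their coefficients add. -/
theorem eventually_jordanLeft (a b c d : C) (x y z w : LaurentPolynomial k) :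
    ∀ᶠ K in atTop, coeff a x * (coeff b y * (coeff c z * coeff d w))
        + coeff b y * (coeff a x * coeff c z) * coeff d w
        + coeff c z * (coeff b y * (coeff a x * coeff d w)) =
      ∑ n ∈ range K, ∑ m ∈ range K, ∑ l ∈ range K, coeff (jordanLeft k n m l a b c d)
        (hasse k n x * hasse k m y * hasse k l z * w) := by
  filter_upwards [eventually_coeff_mul_mul_mul a b c d x y z w,
    eventually_coeff_mul_mul_mul_coeff a b c d x y z w,
    eventually_coeff_mul_mul_mul c b a d z y x w] with K h₁ h₂ h₃
  simp only [jordanLeft, coeff_add_left, sum_add_distrib]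
  rw [h₁, h₂, h₃]
  refine congrArg₂ _ (congrArg₂ _ ?_ (sum_comm.trans ?_)) ((sum_range_reverse _ _).trans ?_) <;>
  exact sum_congr rfl fun n _ => sum_congr rfl fun m _ => sum_congr rfl fun l _ =>
    congrArg (coeff _) (by ring)

theorem eventually_jordanRight (a b c d : C) (x y z w : LaurentPolynomial k) :
    ∀ᶠ K in atTop, coeff a x * coeff b y * (coeff c z * coeff d w)
        + coeff a x * coeff c z * (coeff b y * coeff d w)
        + coeff c z * coeff b y * (coeff a x * coeff d w) =
      ∑ n ∈ range K, ∑ m ∈ range K, ∑ l ∈ range K, coeff (jordanRight k n m l a b c d)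
        (hasse k n x * hasse k m y * hasse k l z * w) := by
  filter_upwards [eventually_mul_mul_mul a b c d x y z w,
    eventually_mul_mul_mul a c b d x z y w,
    eventually_mul_mul_mul c b a d z y x w] with K h₁ h₂ h₃
  simp only [jordanRight, coeff_add_left, sum_add_distrib]
  rw [h₁, h₂, h₃]
  refine congrArg₂ _ (congrArg₂ _ ?_ ((sum_congr rfl fun _ _ => sum_comm).trans ?_))
    ((sum_range_reverse _ _).trans ?_) <;>
  exact sum_congr rfl fun n _ => sum_congr rfl fun m _ => sum_congr rfl fun l _ =>
    congrArg (coeff _) (by ring)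

/-- The linearized Jordan identity in the coefficient algebra is equivalent to the conformal Jordan
identity. -/
theorem linearized_jordan_coeff_iff [CharZero k] :
    (∀ u v u' v' : Coeff k C, u * (v * (u' * v')) + v * (u * u') * v' + u' * (v * (u * v')) =
      u * v * (u' * v') + u * u' * (v * v') + u' * v * (u * v')) ↔
    ∀ (n m l : ℕ) (a b c d : C), jordanLeft k n m l a b c d = jordanRight k n m l a b c d := by
  constructor
  · intro h n m l a b c d
    -- These exponents isolate the coefficient at (n, m, l) under `coeffResidue`; `K` must exceed
    -- all three indices so that this term is in the sum.
    obtain ⟨K, hl, hr, hK⟩ := ((eventually_jordanLeft (k := k) a b c d (LaurentPolynomial.T n)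
      (LaurentPolynomial.T m) (LaurentPolynomial.T l) (LaurentPolynomial.T (-1))).and
      ((eventually_jordanRight (k := k) a b c d (LaurentPolynomial.T n) (LaurentPolynomial.T m)
      (LaurentPolynomial.T l) (LaurentPolynomial.T (-1))).and
      (eventually_gt_atTop (n + m + l)))).exists
    have h' := congrArg (coeffResidue (k := k)) (hl.symm.trans ((h _ _ _ _).trans hr))
    simp only [map_sum] at h'
    rwa [coeffResidue_coeff_hasse _ n m l (by omega) (by omega) (by omega),
      coeffResidue_coeff_hasse _ n m l (by omega) (by omega) (by omega)] at h'
  · intro h u v u' v'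
    have hgen (a b c d : C) (x y z w : LaurentPolynomial k) :
        coeff a x * (coeff b y * (coeff c z * coeff d w))
          + coeff b y * (coeff a x * coeff c z) * coeff d w
          + coeff c z * (coeff b y * (coeff a x * coeff d w)) =
        coeff a x * coeff b y * (coeff c z * coeff d w)
          + coeff a x * coeff c z * (coeff b y * coeff d w)
          + coeff c z * coeff b y * (coeff a x * coeff d w) := by
      obtain ⟨K, hl, hr⟩ := ((eventually_jordanLeft a b c d x y z w).and
        (eventually_jordanRight a b c d x y z w)).exists
      rw [hl, hr]
      simp only [h]
    induction u using coeff_induction with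
    | add u₁ u₂ h₁ h₂ =>
      simp only [add_mul, mul_add]
      convert congrArg₂ (· + ·) h₁ h₂ using 1 <;> abel
    | coeff a x =>
    induction v using coeff_induction with
    | add u₁ u₂ h₁ h₂ =>
      simp only [add_mul, mul_add]
      convert congrArg₂ (· + ·) h₁ h₂ using 1 <;> abel
    | coeff b y =>
    induction u' using coeff_induction with
    | add u₁ u₂ h₁ h₂ =>
      simp only [add_mul, mul_add]
      convert congrArg₂ (· + ·) h₁ h₂ using 1 <;> abel
    | coeff c z =>
    induction v' using coeff_induction with
    | add u₁ u₂ h₁ h₂ =>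
      simp only [mul_add]
      convert congrArg₂ (· + ·) h₁ h₂ using 1 <;> abel
    | coeff d w => exact hgen a b c d x y z w

end Main

end ConformalAlgebra

theorem mainTheorem4 (k : Type*) [Field k] [CharZero k]
    (C : Type*) [AddCommGroup C] [Module k C] [Module k[X] C] [IsScalarTower k k[X] C]
    [ConformalAlgebra k C] (hC : ConformalAlgebra.IsCommutative k C) :
    ConformalAlgebra.IsJordan k C ↔
      ∀ (n m l : ℕ) (a b c d : C),
        a ∘[k, n] (b ∘[k, m] (c ∘[k, l] d))
          + ∑ i ∈ Finset.range (n + 1), ∑ j ∈ Finset.range (m + 1),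
              (n.choose i * m.choose j) •
                ((b ∘[k, m - j] (a ∘[k, n - i] c)) ∘[k, l + i + j] d)
          + c ∘[k, l] (b ∘[k, m] (a ∘[k, n] d))
        = ∑ i ∈ Finset.range (n + 1), n.choose i •
              ((a ∘[k, n - i] b) ∘[k, m + i] (c ∘[k, l] d))
          + ∑ i ∈ Finset.range (n + 1), n.choose i •
              ((a ∘[k, n - i] c) ∘[k, l + i] (b ∘[k, m] d))
          + ∑ i ∈ Finset.range (l + 1), l.choose i •
              ((c ∘[k, l - i] b) ∘[k, m + i] (a ∘[k, n] d)) := by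
  let : NonUnitalNonAssocCommRing (ConformalAlgebra.Coeff k C) := { mul_comm := hC }
  -- Characteristic zero makes nonzero integers invertible in `k`, so the factors 2 and 3 can be
  -- cancelled.
  have : IsAddTorsionFree (ConformalAlgebra.Coeff k C) := ⟨fun n hn u v huv =>
    smul_right_injective (ConformalAlgebra.Coeff k C) (Nat.cast_ne_zero (R := k).2 hn)
      (by simpa only [Nat.cast_smul_eq_nsmul] using huv)⟩
  have key : ConformalAlgebra.IsJordan k C ↔ ∀ u v u' v' : ConformalAlgebra.Coeff k C,
      u * (v * (u' * v')) + v * (u * u') * v' + u' * (v * (u * v')) =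
        u * v * (u' * v') + u * u' * (v * v') + u' * v * (u * v') :=
    ⟨fun h => ConformalAlgebra.linearized_jordan h.2, fun h => ⟨hC, ConformalAlgebra.jordan_of_linearized h⟩⟩
  rw [key, ConformalAlgebra.linearized_jordan_coeff_iff]
  simp only [ConformalAlgebra.jordanLeft, ConformalAlgebra.jordanRight,
    ConformalAlgebra.nestedProd, Finset.smul_sum, smul_smul]
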